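/- Let $\mathcal A$ be a finite alphabet. A labelled graph is a finite directed graph (loops and parallel edges allowed) whose edges carry labels in $\mathcal A$. Let $\mathcal X\subseteq\mathcal A^{\mathbb Z}$ be an irreducible sofic shift, i.e. the set of labels of bi-infinite paths of a labelled graph, such that for all words $u,v$ of $\mathcal X$, either $uv$ is a word of $\mathcal X$ or $uwv$ is a word of $\mathcal X$ for some word $w$ of $\mathcal X$. Let $\mathcal G$ be the minimal right-resolving presentation of $\mathcal X$: a labelled graph without sources and sinks that presents $\mathcal X$, in which distinct edges leaving the same vertex have distinct labels, and which has the fewest vertices among all such presentations of $\mathcal X$. Let $V$ be its vertex set, linearly ordered, $S=|V|$, and let $\lambda$ be the spectral radius of its adjacency matrix (whose $(u,v)$ entry is the number of edges from $u$ to $v$). For $v\in V$ and $a\in\mathcal A$ let $v(a)$ be the terminal vertex of the edge leaving $v$ with label $a$, if there is one. For $1\le j\le S$ let $\mathcal G_j$ be the following labelled graph. Its vertices are the $j$-element subsets of $V$. For each $a\in\mathcal A$ there is an edge from $\{v_1<\dots<v_j\}$ to $\{\tilde v_1<\dots<\tilde v_j\}$ if $v_1(a),\dots,v_j(a)$ are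 all defined, distinct and contained in $\{\tilde v_1,\dots,\tilde v_j\}$; its label is $a$ if $(v_1(a),\dots,v_j(a))$ is an even permutation of $(\tilde v_1,\dots,\tilde v_j)$, and $-a$ otherwise. Let $\tilde{\mathcal G}_j$ be $\mathcal G_j$ with every negative label $-a$ replaced by $a$, and let $\tilde A_j$ be its adjacency matrix. Then $\rho(\tilde A_j)<\lambda$ for every $j$ with $2\le j\le S$, where $\rho$ denotes the spectral radius. -/

import Mathlib

/-- A directed graph with vertices `V`, edges `E` (parallel edges and loops are allowed), each edge
carrying a label in `A`. -/
structure LabelledGraph (V E A : Type*) where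
  /-- The initial vertex of an edge. -/
  init : E → V
  /-- The terminal vertex of an edge. -/
  term : E → V
  /-- The label of an edge. -/
  label : E → A

/-- The set of words (finite sequences) occurring in the points of `X`. -/
def words {A : Type*} (X : Set (ℤ → A)) : Set (List A) :=
  {w | ∃ x ∈ X, ∃ k : ℤ, ∀ (i : ℕ) (hi : i < w.length), x (k + i) = w[i]}

/-- Irreducibility of a shift space. -/
def IsIrreducibleShift {A : Type*} (X : Set (ℤ → A)) : Prop :=
  ∀ u ∈ words X, ∀ v ∈ words X, u ++ v ∈ words X ∨ ∃ w ∈ words X, u ++ w ++ v ∈ words X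

namespace LabelledGraph

/-- No vertex is a source or a sink. -/
def IsEssential {V E A : Type*} (G : LabelledGraph V E A) : Prop :=
  ∀ v : V, (∃ e, G.term e = v) ∧ (∃ e, G.init e = v)

/-- Distinct edges leaving the same vertex have distinct labels. -/
def IsRightResolving {V E A : Type*} (G : LabelledGraph V E A) : Prop :=
  ∀ e e' : E, G.init e = G.init e' → G.label e = G.label e' → e = e'

/-- The set of bi-infinite paths. -/
def biinfinitePaths {V E A : Type*} (G : LabelledGraph V E A) : Set (ℤ → E) :=
  {p | ∀ k : ℤ, G.term (p k) = G.init (p (k + 1))}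

/-- The sofic shift presented by a (finite) labelled graph: the set of labels of its bi-infinite
paths. -/
def soficShift {V E A : Type*} (G : LabelledGraph V E A) : Set (ℤ → A) :=
  {x | ∃ p ∈ G.biinfinitePaths, x = fun k => G.label (p k)}

/-- `G` is a right-resolving presentation of `X` (without sources and sinks). -/
structure IsRightResolvingPresentation {V E A : Type*} (G : LabelledGraph V E A)
    (X : Set (ℤ → A)) : Prop where
  essential : G.IsEssential
  rightResolving : G.IsRightResolving
  presents : G.soficShift = X

/-- `G` has the fewest vertices among all finite right-resolving presentations of `X`. -/
structure IsMinimalRightResolvingPresentation {V : Type*} {E : Type*} {A : Type*}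
    (G : LabelledGraph V E A) (X : Set (ℤ → A)) : Prop
    extends G.IsRightResolvingPresentation X where
  minimal : ∀ (V' : Type) (E' : Type) [Finite V'] [Finite E'] (G' : LabelledGraph V' E' A),
    G'.IsRightResolvingPresentation X → Nat.card V ≤ Nat.card V'

/-- The adjacency matrix: the `(u, v)` entry is the number of edges from `u` to `v`. -/
noncomputable def adjMatrix {V E A : Type*} (G : LabelledGraph V E A) : Matrix V V ℂ :=
  Matrix.of fun u v => (Nat.card {e : E // G.init e = u ∧ G.term e = v} : ℂ)

open scoped Classical in
/-- The vertex `v(a)`: the terminal vertex of the edge leaving `v` with label `a` (unique when `G`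
is right-resolving), and `none` if there is no such edge. -/
noncomputable def next {V E A : Type*} (G : LabelledGraph V E A) (v : V) (a : A) : Option V :=
  if h : ∃ e, G.init e = v ∧ G.label e = a then some (G.term h.choose) else none

/-- The sets of `j` distinct vertices. -/
abbrev Subsets (V : Type*) (j : ℕ) : Type _ := {s : Finset V // s.card = j}

/-- There is an edge for `a` from `s` to `t` when all `v(a)`, `v ∈ s`, are defined, contained in `t`
and distinct. -/
def IsSubsetEdge {V E A : Type*} (G : LabelledGraph V E A) {j : ℕ} (s : Subsets V j) (a : A)
    (t : Subsets V j) : Prop :=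
  (∀ v ∈ s.1, ∃ u ∈ t.1, G.next v a = some u) ∧
    ∀ v ∈ s.1, ∀ v' ∈ s.1, G.next v a = G.next v' a → v = v'

/-- With `s = {v₁ < … < v_j}` and `t = {t₁ < … < t_j}`, the tuple `(v₁(a), …, v_j(a))` is an even
permutation of `(t₁, …, t_j)`. -/
def IsEvenEdge {V E A : Type*} [LinearOrder V] (G : LabelledGraph V E A) {j : ℕ}
    (s : Subsets V j) (a : A) (t : Subsets V j) : Prop :=
  ∃ π : Equiv.Perm (Fin j), Equiv.Perm.sign π = 1 ∧
    ∀ i : Fin j, G.next (s.1.orderEmbOfFin s.2 i) a = some (t.1.orderEmbOfFin t.2 (π i))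

/-- The edges of the `j`-subset graph. -/
abbrev SubsetEdges {V E A : Type*} (G : LabelledGraph V E A) (j : ℕ) : Type _ :=
  {e : Subsets V j × A × Subsets V j // G.IsSubsetEdge e.1 e.2.1 e.2.2}

open scoped Classical in
/-- The `j`-subset graph. The labels `a` and `-a` are encoded as `(a, 1)` and `(a, -1)`. -/
noncomputable def subsetGraph {V E A : Type*} [LinearOrder V] (G : LabelledGraph V E A) (j : ℕ) :
    LabelledGraph (Subsets V j) (G.SubsetEdges j) (A × ℤˣ) where
  init e := e.1.1
  term e := e.1.2.2
  label e := (e.1.2.1, if G.IsEvenEdge e.1.1 e.1.2.1 e.1.2.2 then 1 else -1)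

/-- The `j`-subset graph with all negative labels made positive. -/
noncomputable def positiveSubsetGraph {V E A : Type*} [LinearOrder V] (G : LabelledGraph V E A)
    (j : ℕ) : LabelledGraph (Subsets V j) (G.SubsetEdges j) A where
  init := (G.subsetGraph j).init
  term := (G.subsetGraph j).term
  label e := ((G.subsetGraph j).label e).1

end LabelledGraph

/-! Let `r > 0` satisfy `A r ≤ λ r` for the adjacency matrix `A` of `G`, and put `f t = ∑ v ∈ t, r
v` on `j`-subsets. An edge labelled `a` from `s` to `t` in the subset graph maps `s` bijectively
onto `t`, so `f t` is the sum of `r (term e)` over the `a`-edges `e` of `G` leaving `s`. Summing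
over labels, `Ã_j f ≤ λ f`; the only loss comes from edges of `G` leaving `s` whose label does not
occur at `s` in the subset graph.

If `λ ≤ ρ(Ã_j)`, a maximum-modulus argument on an eigenvector (`exists_closed_harmonic_set`) gives a
nonempty closed set `T` of subsets on which `Ã_j f = λ f`. There nothing is lost: each label leaving
one vertex of `s ∈ T` leaves all of them, and the successor is again in `T`. Hence all vertices of
`s` have the same follower set. As `2 ≤ j`, this contradicts `eq_of_followerEquiv`.

Minimality is used twice: merging follower-equivalent vertices shows follower separation, and
deleting a vertex shows that every vertex is forced by some word. With irreducibility the latter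
connects any two vertices, which makes `r` positive (`exists_pos_mulVec_le`). -/

/-- Compactness for bi-infinite sequences over a finite set: local constraints satisfiable on every
half-line are simultaneously satisfiable. -/
theorem exists_biinfinite_of_forall_halfline {E : Type*} [Finite E] (P : ℤ → E → E → Prop)
    (h : ∀ n : ℕ, ∃ p : ℤ → E, ∀ k : ℤ, -(n : ℤ) ≤ k → k ≤ n → P k (p k) (p (k + 1))) :
    ∃ p : ℤ → E, ∀ k, P k (p k) (p (k + 1)) := by
  choose p hp using h
  -- The limit is taken coordinatewise along a nonprincipal ultrafilter, which selects one value
  -- since `E` is finite.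
  have key : ∀ k : ℤ, ∃ e : E, ∀ᶠ n in (Filter.hyperfilter ℕ : Filter ℕ), p n k = e := by
    intro k
    have : ∀ᶠ n in (Filter.hyperfilter ℕ : Filter ℕ), ∃ e : E, p n k = e :=
      Filter.Eventually.of_forall fun n => ⟨_, rfl⟩
    rwa [Ultrafilter.eventually_exists_iff] at this
  choose q hq using key
  refine ⟨q, fun k => ?_⟩
  have hlarge : ∀ᶠ n in (Filter.hyperfilter ℕ : Filter ℕ), k.natAbs ≤ n :=
    Filter.Eventually.filter_mono
      (Filter.hyperfilter_le_cofinite.trans_eq Nat.cofinite_eq_atTop) (Filter.eventually_ge_atTop _)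
  obtain ⟨n, h1, h2, h3⟩ := ((hq k).and ((hq (k + 1)).and hlarge)).exists
  rw [← h1, ← h2]
  exact hp n k (by omega) (by omega)

/-! ### Follower sets and reindexing -/

namespace LabelledGraph

variable {V E A : Type*}

/-- The word `w` is the label of a path starting at `v`. -/
def Accepts (G : LabelledGraph V E A) : V → List A → Prop
  | _, [] => True
  | v, a :: w => ∃ e, G.init e = v ∧ G.label e = a ∧ G.Accepts (G.term e) w

/-- Two vertices have the same follower set. -/
def FollowerEquiv (G : LabelledGraph V E A) (u v : V) : Prop :=
  ∀ w, G.Accepts u w ↔ G.Accepts v w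

theorem FollowerEquiv.symm {G : LabelledGraph V E A} {u v : V} (h : G.FollowerEquiv u v) :
    G.FollowerEquiv v u := fun w => (h w).symm

theorem FollowerEquiv.trans {G : LabelledGraph V E A} {u v w : V} (h : G.FollowerEquiv u v)
    (h' : G.FollowerEquiv v w) : G.FollowerEquiv u w := fun x => (h x).trans (h' x)

theorem FollowerEquiv.exists_edge {G : LabelledGraph V E A} {v : V} {e : E}
    (h : G.FollowerEquiv (G.init e) v) : ∃ e', G.init e' = v ∧ G.label e' = G.label e := by
  obtain ⟨e', h1, h2, -⟩ := (h [G.label e]).1 ⟨e, rfl, rfl, trivial⟩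
  exact ⟨e', h1, h2⟩

theorem IsRightResolving.accepts_cons {G : LabelledGraph V E A} (hG : G.IsRightResolving)
    (e : E) (w : List A) : G.Accepts (G.init e) (G.label e :: w) ↔ G.Accepts (G.term e) w := by
  constructor
  · rintro ⟨e', h1, h2, h3⟩
    rwa [hG e' e h1 h2] at h3
  · exact fun h => ⟨e, rfl, rfl, h⟩

theorem FollowerEquiv.term {G : LabelledGraph V E A} (hG : G.IsRightResolving) {e e' : E}
    (h : G.FollowerEquiv (G.init e) (G.init e')) (hl : G.label e = G.label e') :
    G.FollowerEquiv (G.term e) (G.term e') := by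
  intro w
  rw [← hG.accepts_cons e, ← hG.accepts_cons e', hl]
  exact h _

/-- Reindexing a labelled graph along equivalences of vertices and edges. -/
def reindex {V' E' : Type*} (G : LabelledGraph V E A) (f : V ≃ V') (g : E ≃ E') :
    LabelledGraph V' E' A where
  init e := f (G.init (g.symm e))
  term e := f (G.term (g.symm e))
  label e := G.label (g.symm e)

theorem IsRightResolvingPresentation.reindex {V' E' : Type*} {G : LabelledGraph V E A}
    {X : Set (ℤ → A)} (hG : G.IsRightResolvingPresentation X) (f : V ≃ V') (g : E ≃ E') :
    (G.reindex f g).IsRightResolvingPresentation X where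
  essential v := by
    obtain ⟨⟨e, he⟩, ⟨e', he'⟩⟩ := hG.essential (f.symm v)
    exact ⟨⟨g e, by simp [LabelledGraph.reindex, he]⟩, ⟨g e', by simp [LabelledGraph.reindex, he']⟩⟩
  rightResolving e e' h h' :=
    g.symm.injective (hG.rightResolving _ _ (f.injective h) h')
  presents := by
    rw [← hG.presents]
    ext x
    constructor
    · rintro ⟨p, hp, rfl⟩
      exact ⟨fun k => g.symm (p k), fun k => f.injective (hp k), rfl⟩
    · rintro ⟨p, hp, rfl⟩
      refine ⟨fun k => g (p k), fun k => ?_, ?_⟩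
      · simpa [LabelledGraph.reindex] using hp k
      · simp [LabelledGraph.reindex]

/-- Minimality holds against presentations in any universe. -/
theorem IsMinimalRightResolvingPresentation.card_le {V' E' : Type*} [Finite V'] [Finite E']
    {G : LabelledGraph V E A} {X : Set (ℤ → A)} (hG : G.IsMinimalRightResolvingPresentation X)
    {G' : LabelledGraph V' E' A} (hG' : G'.IsRightResolvingPresentation X) :
    Nat.card V ≤ Nat.card V' := by
  simpa using hG.minimal (Fin (Nat.card V')) (Fin (Nat.card E')) _
    (hG'.reindex (Finite.equivFin V') (Finite.equivFin E'))

/-! ### Deleting a vertex: forcing words and connectedness -/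

theorem shift_mem_biinfinitePaths {G : LabelledGraph V E A} {p : ℤ → E}
    (hp : p ∈ G.biinfinitePaths) (n : ℤ) : (fun k => p (k + n)) ∈ G.biinfinitePaths := by
  intro k
  have := hp (k + n)
  rwa [show k + n + 1 = k + 1 + n by ring] at this

/-- The subgraph of all bi-infinite paths that avoid a vertex. -/
def avoiding (G : LabelledGraph V E A) (v : V) :
    LabelledGraph {u : V // ∃ p ∈ G.biinfinitePaths, (∀ k, G.init (p k) ≠ v) ∧ ∃ k, G.init (p k) = u}
      {e : E // ∃ p ∈ G.biinfinitePaths, (∀ k, G.init (p k) ≠ v) ∧ ∃ k, p k = e} A where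
  init e := ⟨G.init e.1, by
    obtain ⟨p, hp, h, k, hk⟩ := e.2
    exact ⟨p, hp, h, k, by rw [hk]⟩⟩
  term e := ⟨G.term e.1, by
    obtain ⟨p, hp, h, k, hk⟩ := e.2
    exact ⟨p, hp, h, k + 1, by rw [← hk, hp k]⟩⟩
  label e := G.label e.1

/-- Each central window of a point of `X` is read by a path that avoids `v` during the window;
compactness glues these into one bi-infinite path avoiding `v` throughout, so deleting `v` loses no
point. -/
theorem avoiding_isRightResolvingPresentation {G : LabelledGraph V E A} [Finite E]
    {X : Set (ℤ → A)} (hG : G.IsRightResolvingPresentation X) (v : V)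
    (h : ∀ u ∈ words X, ∃ p ∈ G.biinfinitePaths, ∃ k : ℤ,
      (∀ (i : ℕ) (hi : i < u.length), G.label (p (k + i)) = u[i]) ∧
        ∀ i : ℕ, i ≤ u.length → G.init (p (k + i)) ≠ v) :
    (G.avoiding v).IsRightResolvingPresentation X where
  essential := by
    rintro ⟨u, p, hp, h, k, hk⟩
    refine ⟨⟨⟨p (k - 1), p, hp, h, k - 1, rfl⟩, Subtype.ext ?_⟩,
      ⟨⟨p k, p, hp, h, k, rfl⟩, Subtype.ext hk⟩⟩
    have := hp (k - 1)
    rw [sub_add_cancel, hk] at this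
    exact this
  rightResolving e e' h h' :=
    Subtype.ext (hG.rightResolving _ _ (congrArg Subtype.val h) h')
  presents := by
    apply Set.Subset.antisymm
    · rintro _ ⟨p, hp, rfl⟩
      rw [← hG.presents]
      exact ⟨fun k => (p k).1, fun k => congrArg Subtype.val (hp k), rfl⟩
    · intro x hx
      obtain ⟨p, hp⟩ := exists_biinfinite_of_forall_halfline
        (fun k e e' => G.term e = G.init e' ∧ G.label e = x k ∧ G.init e ≠ v) (by
          intro n
          obtain ⟨p, hp, m, h1, h2⟩ := h (List.ofFn fun i : Fin (2 * n + 1) => x (-n + (i : ℕ)))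
            ⟨x, hx, -n, fun i hi => by rw [List.getElem_ofFn]⟩
          simp only [List.length_ofFn, List.getElem_ofFn] at h1 h2
          refine ⟨fun k => p (k + (m + n)), fun k hk hk' =>
            ⟨shift_mem_biinfinitePaths hp _ k, ?_, ?_⟩⟩
          · have := h1 (k + n).toNat (by omega)
            rw [show m + ((k + n).toNat : ℤ) = k + (m + n) by omega,
              show -(n : ℤ) + ((k + n).toNat : ℤ) = k by omega] at this
            exact this
          · have := h2 (k + n).toNat (by omega)
            rw [show m + ((k + n).toNat : ℤ) = k + (m + n) by omega] at this
            exact this)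
      refine ⟨fun k => ⟨p k, p, fun k => (hp k).1, fun k => (hp k).2.2, k, rfl⟩,
        fun k => Subtype.ext (hp k).1, ?_⟩
      ext k
      exact (hp k).2.1.symm

/-- In a minimal presentation, every vertex is forced by some word. -/
theorem IsMinimalRightResolvingPresentation.exists_forcing_word {G : LabelledGraph V E A}
    [Finite V] [Finite E] {X : Set (ℤ → A)} (hG : G.IsMinimalRightResolvingPresentation X) (v : V) :
    ∃ u ∈ words X, ∀ p ∈ G.biinfinitePaths, ∀ k : ℤ,
      (∀ (i : ℕ) (hi : i < u.length), G.label (p (k + i)) = u[i]) →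
        ∃ i : ℕ, i ≤ u.length ∧ G.init (p (k + i)) = v := by
  by_contra! hcon
  have h := hG.card_le (avoiding_isRightResolvingPresentation hG.toIsRightResolvingPresentation v
    hcon)
  refine absurd h (not_le.2 ?_)
  apply Finite.card_subtype_lt (x := v)
  rintro ⟨p, -, h1, k, hk⟩
  exact h1 k hk

/-- There is a bi-infinite path that passes through `v` and, at the same time or later, `v'`. -/
theorem IsMinimalRightResolvingPresentation.exists_path {G : LabelledGraph V E A}
    [Finite V] [Finite E] {X : Set (ℤ → A)} (hX : IsIrreducibleShift X)
    (hG : G.IsMinimalRightResolvingPresentation X) (v v' : V) :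
    ∃ p ∈ G.biinfinitePaths, ∃ (k : ℤ) (n : ℕ), G.init (p k) = v ∧ G.init (p (k + n)) = v' := by
  obtain ⟨u, hu, hu'⟩ := hG.exists_forcing_word v
  obtain ⟨u₁, hu₁, hu₁'⟩ := hG.exists_forcing_word v'
  obtain ⟨w, x, hx, k, hk⟩ : ∃ w, u ++ w ++ u₁ ∈ words X := by
    rcases hX u hu u₁ hu₁ with h | ⟨w, -, h⟩
    · exact ⟨[], by simpa using h⟩
    · exact ⟨w, h⟩
  rw [← hG.presents] at hx
  obtain ⟨p, hp, rfl⟩ := hx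
  obtain ⟨i, hi, hi'⟩ := hu' p hp k fun i hi => by
    refine (hk i (by simp; omega)).trans ?_
    simp [hi]
  -- The occurrence of `u₁` begins at offset `u.length + w.length ≥ i`, so `v'` is visited no
  -- earlier than `v`.
  obtain ⟨l, hl, hl'⟩ := hu₁' p hp (k + (u.length + w.length : ℕ)) fun l hl => by
    have := hk (u.length + w.length + l) (by simp; omega)
    push_cast at this ⊢
    rw [add_assoc k, this]
    simp [add_assoc]
  refine ⟨p, hp, k + i, u.length + w.length + l - i, hi', ?_⟩
  rw [← hl']
  congr 2
  omega

/-! ### Merging vertices with equal follower sets -/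

/-- The quotient of a graph by a retraction `ρ` onto a set of representatives of the vertices. -/
def merge (G : LabelledGraph V E A) (ρ : V → V) :
    LabelledGraph (Set.range ρ) {e : E // G.init e ∈ Set.range ρ} A where
  init e := ⟨G.init e.1, e.2⟩
  term e := ⟨ρ (G.term e.1), Set.mem_range_self _⟩
  label e := G.label e.1

/-- Equivalent vertices have the same outgoing labels and equivalent successors. A path of the
quotient therefore lifts edge by edge, but only forwards from a starting time `-n`; compactness
supplies a bi-infinite lift. -/
theorem merge_isRightResolvingPresentation {G : LabelledGraph V E A} [Finite E]
    {X : Set (ℤ → A)} (hG : G.IsRightResolvingPresentation X) (ρ : V → V)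
    (hρ : ∀ v, G.FollowerEquiv v (ρ v))
    (hρ' : ∀ u v, G.FollowerEquiv u v → ρ u = ρ v) :
    (G.merge ρ).IsRightResolvingPresentation X where
  essential := by
    rintro ⟨_, v, rfl⟩
    obtain ⟨⟨e, he⟩, -⟩ := hG.essential v
    obtain ⟨-, ⟨e', he'⟩⟩ := hG.essential (ρ v)
    obtain ⟨e₁, h₁, h₁'⟩ := (hρ (G.init e)).exists_edge
    refine ⟨⟨⟨e₁, by rw [h₁]; exact Set.mem_range_self _⟩, Subtype.ext ?_⟩,
      ⟨⟨e', by rw [he']; exact Set.mem_range_self _⟩, Subtype.ext he'⟩⟩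
    apply hρ'
    rw [← he]
    refine FollowerEquiv.term hG.rightResolving ?_ h₁'
    rw [h₁]
    exact (hρ _).symm
  rightResolving e e' h h' :=
    Subtype.ext (hG.rightResolving _ _ (congrArg Subtype.val h) h')
  presents := by
    apply Set.Subset.antisymm
    · rintro _ ⟨q, hq, rfl⟩
      rw [← hG.presents]
      have hq' : ∀ k, ρ (G.term (q k).1) = G.init (q (k + 1)).1 :=
        fun k => congrArg Subtype.val (hq k)
      suffices h : ∃ p : ℤ → E, ∀ k, G.term (p k) = G.init (p (k + 1)) ∧
          G.label (p k) = G.label (q k).1 by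
        obtain ⟨p, hp⟩ := h
        exact ⟨p, fun k => (hp k).1, funext fun k => (hp k).2.symm⟩
      apply exists_biinfinite_of_forall_halfline
        (fun k e e' => G.term e = G.init e' ∧ G.label e = G.label (q k).1)
      intro n
      -- Admissible lifts at time `-n + i`: same label, and an initial vertex equivalent to that of
      -- the quotient path.
      let T (i : ℕ) := {e : E // G.FollowerEquiv (G.init (q (-n + i)).1) (G.init e) ∧
        G.label e = G.label (q (-n + i)).1}
      have step : ∀ (i : ℕ) (e : T i), ∃ e' : T (i + 1), G.term e.1 = G.init e'.1 := by
        rintro i ⟨e, h1, h2⟩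
        have h3 : G.FollowerEquiv (G.init (q (-n + (i + 1 : ℕ))).1) (G.term e) := by
          have := hq' (-n + i)
          rw [show -(n : ℤ) + (i + 1 : ℕ) = -n + i + 1 by push_cast; ring, ← this]
          exact (hρ _).symm.trans (FollowerEquiv.term hG.rightResolving h1 h2.symm)
        obtain ⟨e', h4, h5⟩ := h3.exists_edge
        exact ⟨⟨e', by rwa [h4], h5⟩, h4.symm⟩
      choose f hf using step
      let s : (i : ℕ) → T i := fun i => Nat.rec ⟨(q (-n + (0 : ℕ))).1, fun _ => Iff.rfl, rfl⟩ f i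
      refine ⟨fun k => (s (k + n).toNat).1, fun k hk _ => ⟨?_, ?_⟩⟩
      · dsimp only
        rw [show (k + 1 + n).toNat = (k + n).toNat + 1 by omega]
        exact hf _ (s (k + n).toNat)
      · have := (s (k + n).toNat).2.2
        exact this.trans (by rw [show -(n : ℤ) + ((k + n).toNat : ℕ) = k by omega])
    · rw [← hG.presents]
      rintro _ ⟨p, hp, rfl⟩
      choose q hq hq' using fun k => (hρ (G.init (p k))).exists_edge
      refine ⟨fun k => ⟨q k, by rw [hq]; exact Set.mem_range_self _⟩,
        fun k => Subtype.ext ?_, funext fun k => (hq' k).symm⟩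
      change ρ (G.term (q k)) = G.init (q (k + 1))
      rw [hq, ← hp k]
      apply hρ'
      refine FollowerEquiv.term hG.rightResolving ?_ (hq' k)
      rw [hq]
      exact (hρ _).symm

/-- A minimal presentation is follower-separated. -/
theorem IsMinimalRightResolvingPresentation.eq_of_followerEquiv {G : LabelledGraph V E A}
    [Finite V] [Finite E] {X : Set (ℤ → A)} (hG : G.IsMinimalRightResolvingPresentation X)
    {v v' : V} (h : G.FollowerEquiv v v') : v = v' := by
  let S : Setoid V := ⟨G.FollowerEquiv, fun _ _ => Iff.rfl, fun h => h.symm, fun h h' => h.trans h'⟩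
  let ρ : V → V := fun u => (Quotient.mk S u).out
  have hρ : ∀ u, G.FollowerEquiv u (ρ u) := fun u => (Quotient.mk_out (s := S) u).symm
  have hρ' : ∀ u u', G.FollowerEquiv u u' → ρ u = ρ u' := fun u u' huu' =>
    congrArg Quotient.out (Quotient.sound (s := S) huu')
  have hc := hG.card_le
    (merge_isRightResolvingPresentation hG.toIsRightResolvingPresentation ρ hρ hρ')
  have hsurj : Function.Surjective ρ := by
    intro u
    by_contra hu
    exact absurd hc (not_le.2 (Finite.card_subtype_lt (p := (· ∈ Set.range ρ)) hu))
  exact Finite.injective_iff_surjective.2 hsurj (hρ' _ _ h)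

end LabelledGraph
-- Nonnegative matrices and superharmonic vectors
open Filter Topology Matrix

theorem eventually_norm_pow_le_of_spectralRadius_lt {R : Type*} [NormedRing R] [NormedAlgebra ℂ R]
    [CompleteSpace R] (a : R) {c : ℝ} (hc : spectralRadius ℂ a < ENNReal.ofReal c) :
    ∀ᶠ n : ℕ in atTop, ‖a ^ n‖ ≤ c ^ n := by
  have hc0 : 0 < c := ENNReal.ofReal_pos.1 (bot_le.trans_lt hc)
  have h := (spectrum.pow_norm_pow_one_div_tendsto_nhds_spectralRadius a).eventually_lt_const hc
  filter_upwards [h, eventually_ge_atTop 1] with n hn hn1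
  rw [ENNReal.ofReal_lt_ofReal_iff hc0] at hn
  have hn0 : n ≠ 0 := by omega
  calc ‖a ^ n‖ = (‖a ^ n‖ ^ (1 / n : ℝ)) ^ n := by
        rw [one_div, Real.rpow_inv_natCast_pow (norm_nonneg _) hn0]
    _ ≤ c ^ n := by gcongr

namespace Matrix

variable {n : Type*} [Fintype n]

section
attribute [local instance] Matrix.linftyOpNormedRing Matrix.linftyOpNormedAlgebra

theorem spectralRadius_ne_top [DecidableEq n] (B : Matrix n n ℂ) :
    spectralRadius ℂ B ≠ ⊤ := by
  rcases isEmpty_or_nonempty n with h | h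
  · simp [spectrum.SpectralRadius.of_subsingleton]
  · exact ne_top_of_le_ne_top ENNReal.coe_ne_top (spectrum.spectralRadius_le_nnnorm B)

theorem exists_norm_eq_toReal_spectralRadius [Nonempty n] [DecidableEq n] (B : Matrix n n ℂ) :
    ∃ (z : ℂ) (x : n → ℂ), x ≠ 0 ∧ B *ᵥ x = z • x ∧ ‖z‖ = (spectralRadius ℂ B).toReal := by
  obtain ⟨z, hz, h⟩ := spectrum.exists_nnnorm_eq_spectralRadius B
  rw [← Matrix.spectrum_toLin', ← Module.End.hasEigenvalue_iff_mem_spectrum] at hz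
  obtain ⟨x, hx⟩ := hz.exists_hasEigenvector
  refine ⟨z, x, hx.2, by simpa using hx.apply_eq_smul, ?_⟩
  rw [← h]
  simp

/-- The vector is the Neumann series `y = ∑ c⁻ᵏ Mᵏ 1`. Its zeroth term makes it positive, and `M y =
c (y - 1) ≤ c y`. For `d` strictly between the spectral radius and `c`, Gelfand's formula bounds the
terms by `(d / c)ᵏ` eventually. -/
theorem exists_pos_mulVec_le_of_spectralRadius_lt [DecidableEq n] (M : Matrix n n ℝ)
    (hM : ∀ i j, 0 ≤ M i j) {c : ℝ}
    (hc : (spectralRadius ℂ (M.map Complex.ofRealHom)).toReal < c) :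
    ∃ y : n → ℝ, (∀ i, 0 < y i) ∧ ∀ i, (M *ᵥ y) i ≤ c * y i := by
  set B := M.map Complex.ofRealHom with hB
  obtain ⟨d, hd, hdc⟩ := exists_between hc
  have hd0 : 0 < d := ENNReal.toReal_nonneg.trans_lt hd
  have hc0 : 0 < c := hd0.trans hdc
  let t (k : ℕ) (i : n) : ℝ := (M ^ k *ᵥ 1) i / c ^ k
  have hMk : ∀ k i j, 0 ≤ (M ^ k) i j := by
    intro k
    induction k with
    | zero => intro i j; rw [pow_zero, Matrix.one_apply]; split_ifs <;> norm_num
    | succ k ih =>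
      intro i j
      rw [pow_succ, Matrix.mul_apply]
      exact Finset.sum_nonneg fun l _ => mul_nonneg (ih i l) (hM l j)
  have ht0 : ∀ k i, 0 ≤ t k i := fun k i =>
    div_nonneg (Finset.sum_nonneg fun j _ => by simpa using hMk k i j) (by positivity)
  have hsum : ∀ i, Summable fun k => t k i := by
    intro i
    have hgeo : Summable fun k : ℕ => (d / c) ^ k :=
      summable_geometric_of_lt_one (by positivity) ((div_lt_one hc0).2 hdc)
    refine Summable.of_norm_bounded_eventually_nat hgeo ?_
    have hd' : spectralRadius ℂ B < ENNReal.ofReal d :=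
      (ENNReal.lt_ofReal_iff_toReal_lt (spectralRadius_ne_top B)).2 hd
    filter_upwards [eventually_norm_pow_le_of_spectralRadius_lt B hd'] with k hk
    have h1 : ((M ^ k *ᵥ 1) i : ℂ) = (B ^ k *ᵥ 1) i := by
      rw [hB, show M.map Complex.ofRealHom = Complex.ofRealHom.mapMatrix M from rfl, ← map_pow]
      simp [Matrix.mulVec, dotProduct]
    have h2 : ‖(B ^ k *ᵥ (1 : n → ℂ)) i‖ ≤ ‖B ^ k‖ := by
      have := Matrix.linfty_opNorm_mulVec (B ^ k) (1 : n → ℂ)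
      have h1' : ‖(1 : n → ℂ)‖ ≤ 1 := (pi_norm_le_iff_of_nonneg zero_le_one).2 fun i => by simp
      calc _ ≤ ‖B ^ k *ᵥ (1 : n → ℂ)‖ := norm_le_pi_norm _ i
        _ ≤ ‖B ^ k‖ * ‖(1 : n → ℂ)‖ := this
        _ ≤ ‖B ^ k‖ * 1 := by gcongr
        _ = ‖B ^ k‖ := mul_one _
    have h3 : ‖(M ^ k *ᵥ 1) i‖ ≤ d ^ k := by
      rw [← Complex.norm_real, h1]
      exact h2.trans hk
    rw [norm_div, div_pow, Real.norm_of_nonneg (pow_nonneg hc0.le k)]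
    gcongr
  refine ⟨fun i => ∑' k, t k i, fun i => ?_, fun i => ?_⟩
  · refine (hsum i).tsum_pos (ht0 · i) 0 ?_
    simp [t]
  · have h1 : (M *ᵥ fun i => ∑' k, t k i) i = ∑' k, c * t (k + 1) i := by
      simp only [Matrix.mulVec, dotProduct, ← tsum_mul_left]
      rw [← Summable.tsum_finsetSum fun j _ => (hsum j).mul_left _]
      congr 1
      ext k
      simp only [t]
      rw [pow_succ' M, ← Matrix.mulVec_mulVec, pow_succ c]
      change _ = c * ((∑ j, M i j * (M ^ k *ᵥ 1) j) / (c ^ k * c))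
      rw [Finset.sum_div, Finset.mul_sum]
      refine Finset.sum_congr rfl fun j _ => ?_
      field_simp
    rw [h1, tsum_mul_left]
    refine mul_le_mul_of_nonneg_left ?_ hc0.le
    change _ ≤ ∑' k, t k i
    rw [(hsum i).tsum_eq_zero_add]
    exact le_add_of_nonneg_left (ht0 0 i)

end

/-- A nonnegative matrix has a nonnegative vector that is superharmonic for its spectral radius. -/
theorem exists_nonneg_mulVec_le_spectralRadius [Nonempty n] [DecidableEq n] (M : Matrix n n ℝ)
    (hM : ∀ i j, 0 ≤ M i j) :
    ∃ r : n → ℝ, (∀ i, 0 ≤ r i) ∧ (∃ i, 0 < r i) ∧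
      ∀ i, (M *ᵥ r) i ≤ (spectralRadius ℂ (M.map Complex.ofRealHom)).toReal * r i := by
  set ρ := (spectralRadius ℂ (M.map Complex.ofRealHom)).toReal with hρ
  -- Normalising into the simplex provides compactness and keeps the limit nonzero as the constants
  -- decrease to `ρ`; positivity of individual entries may be lost.
  have h : ∀ k : ℕ, ∃ y ∈ stdSimplex ℝ n, ∀ i, (M *ᵥ y) i ≤ (ρ + 1 / ((k : ℝ) + 1)) * y i := by
    intro k
    obtain ⟨y, hy, hy'⟩ := exists_pos_mulVec_le_of_spectralRadius_lt M hM
      (c := ρ + 1 / ((k : ℝ) + 1)) (lt_add_of_pos_right _ (by positivity))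
    have hs : 0 < ∑ i, y i := Finset.sum_pos (fun i _ => hy i) Finset.univ_nonempty
    refine ⟨(∑ i, y i)⁻¹ • y, ⟨fun i => ?_, ?_⟩, fun i => ?_⟩
    · exact mul_nonneg (inv_nonneg.2 hs.le) (hy i).le
    · simp [← Finset.mul_sum, hs.ne']
    · rw [Matrix.mulVec_smul, Pi.smul_apply, Pi.smul_apply, smul_eq_mul, smul_eq_mul,
        mul_left_comm]
      exact mul_le_mul_of_nonneg_left (hy' i) (inv_nonneg.2 hs.le)
  choose y hy hy' using h
  obtain ⟨r, hr, φ, hφ, hlim⟩ := (isCompact_stdSimplex ℝ n).tendsto_subseq hy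
  refine ⟨r, hr.1, ?_, fun i => ?_⟩
  · by_contra! hcon
    have := Finset.sum_nonpos fun i (_ : i ∈ Finset.univ) => hcon i
    rw [hr.2] at this
    linarith
  · have h1 : Tendsto (fun k => (M *ᵥ (y ∘ φ) k) i) atTop (𝓝 ((M *ᵥ r) i)) := by
      have hcont : Continuous fun z : n → ℝ => (M *ᵥ z) i := by
        simp only [Matrix.mulVec, dotProduct]
        fun_prop
      exact (hcont.tendsto r).comp hlim
    have h2 : Tendsto (fun k => (ρ + 1 / ((φ k : ℝ) + 1)) * (y ∘ φ) k i) atTop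
        (𝓝 ((ρ + 0) * r i)) :=
      ((tendsto_one_div_add_atTop_nhds_zero_nat.comp hφ.tendsto_atTop).const_add ρ).mul
        ((tendsto_pi_nhds.1 hlim) i)
    rw [add_zero] at h2
    exact le_of_tendsto_of_tendsto' h1 h2 fun k => hy' (φ k) i

/-- If a positive vector `f` is superharmonic for `ρ` and the nonnegative matrix `B` has an
eigenvalue of modulus at least `ρ`, then `f` is harmonic on a nonempty set closed under the
transitions of `B`. -/
theorem exists_closed_harmonic_set [Nonempty n] (B : Matrix n n ℝ) (hB : ∀ i j, 0 ≤ B i j)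
    {f : n → ℝ} (hf : ∀ i, 0 < f i) {ρ : ℝ} (hBf : ∀ i, (B *ᵥ f) i ≤ ρ * f i) {z : ℂ} {x : n → ℂ}
    (hx : x ≠ 0) (hxz : B.map Complex.ofRealHom *ᵥ x = z • x) (hz : ρ ≤ ‖z‖) :
    ∃ T : Set n, T.Nonempty ∧ ∀ s ∈ T, (B *ᵥ f) s = ρ * f s ∧ ∀ t, B s t ≠ 0 → t ∈ T := by
  obtain ⟨s₀, hs₀⟩ := Finite.exists_max fun s => ‖x s‖ / f s
  set m := ‖x s₀‖ / f s₀ with hm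
  have hle : ∀ s, ‖x s‖ ≤ m * f s := fun s => (div_le_iff₀ (hf s)).1 (hs₀ s)
  have hm0 : 0 < m := by
    obtain ⟨s, hs⟩ := Function.ne_iff.1 hx
    have h1 : 0 < ‖x s‖ := norm_pos_iff.2 hs
    exact (div_pos h1 (hf s)).trans_le (hs₀ s)
  refine ⟨{s | ‖x s‖ = m * f s}, ⟨s₀, by simp [hm, (hf s₀).ne']⟩, fun s hs => ?_⟩
  -- The chain `ρ m f s ≤ ‖z‖ ‖x s‖ ≤ ∑ B s t ‖x t‖ ≤ m (B f) s ≤ m ρ f s` has equal ends, so every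
  -- step is an equality; the third one holds termwise, which puts `t` in the set whenever `B s t ≠
  -- 0`.
  have h1 : ‖z‖ * ‖x s‖ ≤ ∑ t, B s t * ‖x t‖ := by
    rw [← norm_mul, ← smul_eq_mul, ← Pi.smul_apply, ← hxz]
    refine (norm_sum_le _ _).trans (Finset.sum_le_sum fun t _ => ?_)
    simp [abs_of_nonneg (hB s t)]
  have h2 : ∀ t, B s t * ‖x t‖ ≤ B s t * (m * f t) := fun t =>
    mul_le_mul_of_nonneg_left (hle t) (hB s t)
  have h3 : ∑ t, B s t * (m * f t) = m * (B *ᵥ f) s := by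
    simp only [Matrix.mulVec, dotProduct, Finset.mul_sum]
    exact Finset.sum_congr rfl fun t _ => mul_left_comm _ _ _
  have h4 : ρ * (m * f s) ≤ ‖z‖ * ‖x s‖ := by
    rw [← show ‖x s‖ = m * f s from hs]
    exact mul_le_mul_of_nonneg_right hz (norm_nonneg _)
  have h5 : m * (B *ᵥ f) s ≤ m * (ρ * f s) := mul_le_mul_of_nonneg_left (hBf s) hm0.le
  have h6 : ∑ t, B s t * ‖x t‖ ≤ ∑ t, B s t * (m * f t) := Finset.sum_le_sum fun t _ => h2 t
  have h7 : ρ * (m * f s) = m * (ρ * f s) := mul_left_comm _ _ _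
  refine ⟨mul_left_cancel₀ hm0.ne' (by linarith), fun t ht => ?_⟩
  have h8 := (Finset.sum_eq_sum_iff_of_le fun t _ => h2 t).1 (by linarith) t (Finset.mem_univ t)
  exact mul_left_cancel₀ ht h8

end Matrix

/-! ### Adjacency matrices as sums over edges -/

namespace LabelledGraph

variable {V E A : Type*}

/-- The adjacency matrix with real entries. -/
noncomputable def realAdjMatrix (G : LabelledGraph V E A) : Matrix V V ℝ :=
  Matrix.of fun u v => (Nat.card {e : E // G.init e = u ∧ G.term e = v} : ℝ)

theorem realAdjMatrix_map (G : LabelledGraph V E A) :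
    G.realAdjMatrix.map Complex.ofRealHom = G.adjMatrix := by
  ext u v
  simp [realAdjMatrix, adjMatrix]

theorem realAdjMatrix_nonneg (G : LabelledGraph V E A) (u v : V) : 0 ≤ G.realAdjMatrix u v :=
  Nat.cast_nonneg _

theorem realAdjMatrix_pos (G : LabelledGraph V E A) [Finite E] (e : E) :
    0 < G.realAdjMatrix (G.init e) (G.term e) := by
  have : Nonempty {e' : E // G.init e' = G.init e ∧ G.term e' = G.term e} := ⟨⟨e, rfl, rfl⟩⟩
  exact Nat.cast_pos.2 Nat.card_pos

theorem realAdjMatrix_mulVec [Fintype V] [DecidableEq V] [Fintype E] (G : LabelledGraph V E A) (f : V → ℝ) (s : V) :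
    (G.realAdjMatrix *ᵥ f) s = ∑ e with G.init e = s, f (G.term e) := by
  rw [← Finset.sum_fiberwise' _ G.term f]
  refine Finset.sum_congr rfl fun v _ => ?_
  rw [Finset.sum_const, nsmul_eq_mul, Finset.filter_filter]
  simp [realAdjMatrix, Nat.card_eq_fintype_card, Fintype.card_subtype]

theorem IsRightResolving.next_eq_some_iff {G : LabelledGraph V E A} (hG : G.IsRightResolving)
    {v u : V} {a : A} :
    G.next v a = some u ↔ ∃ e, G.init e = v ∧ G.label e = a ∧ G.term e = u := by
  unfold next
  split_ifs with h
  · constructor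
    · intro h'
      exact ⟨h.choose, h.choose_spec.1, h.choose_spec.2, Option.some.inj h'⟩
    · rintro ⟨e, h1, h2, h3⟩
      rw [hG h.choose e (h.choose_spec.1.trans h1.symm) (h.choose_spec.2.trans h2.symm), h3]
  · simp only [false_iff]
    rintro ⟨e, h1, h2, -⟩
    exact h ⟨e, h1, h2⟩

/-- A positive superharmonic vector of a minimal presentation of an irreducible shift. -/
theorem IsMinimalRightResolvingPresentation.exists_pos_mulVec_le {G : LabelledGraph V E A}
    [Fintype V] [DecidableEq V] [Nonempty V] [Finite E] {X : Set (ℤ → A)}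
    (hX : IsIrreducibleShift X) (hG : G.IsMinimalRightResolvingPresentation X) :
    ∃ r : V → ℝ, (∀ v, 0 < r v) ∧
      ∀ v, (G.realAdjMatrix *ᵥ r) v ≤ (spectralRadius ℂ G.adjMatrix).toReal * r v := by
  obtain ⟨r, h0, ⟨u, hu⟩, hr⟩ :=
    exists_nonneg_mulVec_le_spectralRadius G.realAdjMatrix G.realAdjMatrix_nonneg
  rw [realAdjMatrix_map] at hr
  refine ⟨r, fun v => ?_, hr⟩
  -- Positivity spreads backwards along edges: if `r` vanished at the initial vertex,
  -- superharmonicity would make every weighted successor vanish. A path from `v` to `u` then gives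
  -- `0 < r v`.
  have hstep : ∀ e, 0 < r (G.term e) → 0 < r (G.init e) := by
    intro e he
    refine (h0 _).lt_of_ne fun h => ?_
    have h1 := hr (G.init e)
    rw [← h, mul_zero] at h1
    have h2 : G.realAdjMatrix (G.init e) (G.term e) * r (G.term e) ≤
        (G.realAdjMatrix *ᵥ r) (G.init e) :=
      Finset.single_le_sum (f := fun t => G.realAdjMatrix (G.init e) t * r t)
        (fun t _ => mul_nonneg (G.realAdjMatrix_nonneg _ t) (h0 t)) (Finset.mem_univ _)
    exact absurd (mul_pos (G.realAdjMatrix_pos e) he) (not_lt.2 (h2.trans h1))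
  obtain ⟨p, hp, k, n, rfl, h⟩ := hG.exists_path hX v u
  rw [← h] at hu
  clear h
  induction n with
  | zero => simpa using hu
  | succ n ih =>
    apply ih
    apply hstep
    rw [hp]
    simpa [add_assoc] using hu

/-! ### Edges of the subset graph in terms of edges of `G` -/

section SubsetGraph

variable [LinearOrder V]

/-- Following the label is injective on the initial subset and lands in a terminal subset of the
same size, so it is a bijection; right-resolving gives exactly one such edge per vertex. -/
theorem positiveSubsetGraph_edge_image {G : LabelledGraph V E A} [Fintype E]
    [DecidableEq A] (hG : G.IsRightResolving) {j : ℕ} (ε : G.SubsetEdges j) (g : V → ℝ) :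
    ∑ u ∈ ((G.positiveSubsetGraph j).term ε).1, g u =
      ∑ e with G.init e ∈ ((G.positiveSubsetGraph j).init ε).1 ∧
        G.label e = (G.positiveSubsetGraph j).label ε, g (G.term e) := by
  obtain ⟨⟨s, a, t⟩, h1, h2⟩ := ε
  change ∑ u ∈ t.1, g u = ∑ e with G.init e ∈ s.1 ∧ G.label e = a, g (G.term e)
  simp only [hG.next_eq_some_iff] at h1
  choose! F hFt hF using h1
  choose φ hφ1 hφ2 hφ3 using hF
  have hinj : Set.InjOn F s.1 := fun v hv v' hv' hvv' => h2 v hv v' hv' (by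
    rw [hG.next_eq_some_iff.2 ⟨φ v hv, hφ1 v hv, hφ2 v hv, hφ3 v hv⟩,
      hG.next_eq_some_iff.2 ⟨φ v' hv', hφ1 v' hv', hφ2 v' hv', hφ3 v' hv'⟩, hvv'])
  have himg : s.1.image F = t.1 := by
    apply Finset.eq_of_subset_of_card_le
    · intro u hu
      obtain ⟨v, hv, rfl⟩ := Finset.mem_image.1 hu
      exact hFt v hv
    · rw [Finset.card_image_of_injOn hinj, s.2, t.2]
  rw [← himg, Finset.sum_image hinj]
  refine Finset.sum_bij φ (fun v hv => ?_) (fun v hv v' hv' h => ?_)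
    (fun e he => ?_) (fun v hv => ?_)
  · simp [hφ1 v hv, hφ2 v hv, hv]
  · rw [← hφ1 v hv, h, hφ1 v' hv']
  · simp only [Finset.mem_filter, Finset.mem_univ, true_and] at he
    refine ⟨G.init e, he.1, hG _ _ (hφ1 _ he.1) ((hφ2 _ he.1).trans he.2.symm)⟩
  · rw [hφ3 v hv]

theorem positiveSubsetGraph_term_mem {G : LabelledGraph V E A} (hG : G.IsRightResolving) {j : ℕ}
    (ε : G.SubsetEdges j) (e : E) (h : G.init e ∈ ((G.positiveSubsetGraph j).init ε).1)
    (hl : G.label e = (G.positiveSubsetGraph j).label ε) :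
    G.term e ∈ ((G.positiveSubsetGraph j).term ε).1 := by
  obtain ⟨u, hu, hu'⟩ := ε.2.1 (G.init e) h
  obtain ⟨e', h1, h2, rfl⟩ := hG.next_eq_some_iff.1 hu'
  rwa [hG e e' h1.symm (hl.trans h2.symm)]

theorem positiveSubsetGraph_exists_edge {G : LabelledGraph V E A} (hG : G.IsRightResolving) {j : ℕ}
    (ε : G.SubsetEdges j) {v : V} (h : v ∈ ((G.positiveSubsetGraph j).init ε).1) :
    ∃ e, G.init e = v ∧ G.label e = (G.positiveSubsetGraph j).label ε := by
  obtain ⟨u, -, hu'⟩ := ε.2.1 v h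
  obtain ⟨e, h1, h2, -⟩ := hG.next_eq_some_iff.1 hu'
  exact ⟨e, h1, h2⟩

theorem positiveSubsetGraph_isRightResolving {G : LabelledGraph V E A} [Fintype E]
    (hG : G.IsRightResolving) (j : ℕ) : (G.positiveSubsetGraph j).IsRightResolving := by
  classical
  intro ε ε' h h'
  have hsub : ∀ δ δ' : G.SubsetEdges j,
      (G.positiveSubsetGraph j).init δ = (G.positiveSubsetGraph j).init δ' →
      (G.positiveSubsetGraph j).label δ = (G.positiveSubsetGraph j).label δ' →
      ((G.positiveSubsetGraph j).term δ).1 = ((G.positiveSubsetGraph j).term δ').1 := by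
    intro δ δ' h h'
    ext u
    -- Indicator functions recover membership in the terminal subset from the sums.
    have := positiveSubsetGraph_edge_image hG δ (fun x => if x = u then 1 else 0)
    rw [h, h', ← positiveSubsetGraph_edge_image hG δ' (fun x => if x = u then 1 else 0)] at this
    simp only [Finset.sum_ite_eq'] at this
    split_ifs at this <;> simp_all
  have h3 := hsub ε ε' h h'
  exact Subtype.ext (Prod.ext h (Prod.ext h' (Subtype.ext h3)))

-- Distinct subset edges leaving `s` have distinct labels, so the corresponding sets of edges of `G`
-- are disjoint. The formula exhibits which edges leaving `s` fail to contribute.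
open scoped Classical in
theorem positiveSubsetGraph_mulVec_sum {G : LabelledGraph V E A} [Fintype V] [Fintype E]
    [Finite A] (hG : G.IsRightResolving) (j : ℕ) (r : V → ℝ) (s : Subsets V j) :
    ((G.positiveSubsetGraph j).realAdjMatrix *ᵥ fun t => ∑ v ∈ t.1, r v) s =
      ∑ e with G.init e ∈ s.1 ∧ ∃ ε, (G.positiveSubsetGraph j).init ε = s ∧
        (G.positiveSubsetGraph j).label ε = G.label e, r (G.term e) := by
  have := Fintype.ofFinite A
  rw [realAdjMatrix_mulVec,
    Finset.sum_congr rfl fun ε _ => positiveSubsetGraph_edge_image hG ε r, ← Finset.sum_biUnion]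
  · refine Finset.sum_congr (Finset.ext fun e => ?_) fun _ _ => rfl
    simp only [Finset.mem_biUnion, Finset.mem_filter, Finset.mem_univ, true_and]
    constructor
    · rintro ⟨ε, rfl, h, h'⟩
      exact ⟨h, ε, rfl, h'.symm⟩
    · rintro ⟨h, ε, rfl, h'⟩
      exact ⟨ε, rfl, h, h'.symm⟩
  · intro ε hε ε' hε' hne
    refine Finset.disjoint_left.2 fun e he he' => hne ?_
    simp only [Finset.coe_filter, Finset.mem_filter, Finset.mem_univ, true_and,
      Set.mem_ofPred_eq] at hε hε' he he'
    exact positiveSubsetGraph_isRightResolving hG j ε ε' (hε.trans hε'.symm)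
      (he.2.symm.trans he'.2)

end SubsetGraph

end LabelledGraph

/-! ### Strict inequality of the spectral radii -/

open LabelledGraph

theorem mainTheorem2 {V E A : Type*} [Fintype V] [LinearOrder V] [Finite E] [Finite A]
    (X : Set (ℤ → A)) (hX : IsIrreducibleShift X)
    (G : LabelledGraph V E A) (hG : G.IsMinimalRightResolvingPresentation X)
    (j : ℕ) (hj : 2 ≤ j) (hjS : j ≤ Fintype.card V) :
    spectralRadius ℂ (G.positiveSubsetGraph j).adjMatrix < spectralRadius ℂ G.adjMatrix := by
  classical
  have := Fintype.ofFinite E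
  have hV : Nonempty V := Fintype.card_pos_iff.1 (by omega)
  have hN : Nonempty (Subsets V j) := by
    obtain ⟨s, -, hs⟩ := Finset.exists_subset_card_eq (s := (Finset.univ : Finset V)) hjS
    exact ⟨⟨s, hs⟩⟩
  have hR := hG.rightResolving
  obtain ⟨r, hr0, hr⟩ := hG.exists_pos_mulVec_le hX
  obtain ⟨z, x, hx, hxz, hz⟩ := exists_norm_eq_toReal_spectralRadius (G.positiveSubsetGraph j).adjMatrix
  by_contra! hle
  have hle' := ENNReal.toReal_mono (spectralRadius_ne_top _) hle
  rw [← hz] at hle'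
  rw [← realAdjMatrix_map] at hxz
  have hsup : ∀ s : Subsets V j, ∑ e with G.init e ∈ s.1, r (G.term e) ≤
      (spectralRadius ℂ G.adjMatrix).toReal * ∑ v ∈ s.1, r v := by
    intro s
    rw [Finset.mul_sum, ← Finset.sum_fiberwise_of_maps_to (t := s.1) (g := G.init) (by simp)]
    refine Finset.sum_le_sum fun v hv => le_trans (le_of_eq ?_) (hr v)
    rw [realAdjMatrix_mulVec, Finset.filter_filter]
    refine Finset.sum_congr (Finset.filter_congr fun e _ => ?_) fun _ _ => rfl
    exact ⟨fun h => h.2, fun h => ⟨h ▸ hv, h⟩⟩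
  have hsubset : ∀ s : Subsets V j, (Finset.univ.filter fun e => G.init e ∈ s.1 ∧
      ∃ ε, (G.positiveSubsetGraph j).init ε = s ∧
        (G.positiveSubsetGraph j).label ε = G.label e) ⊆
      Finset.univ.filter fun e => G.init e ∈ s.1 := fun s e he => by
    simp only [Finset.mem_filter, Finset.mem_univ, true_and] at he ⊢
    exact he.1
  obtain ⟨T, ⟨s₀, hs₀⟩, hT⟩ := exists_closed_harmonic_set
    (G.positiveSubsetGraph j).realAdjMatrix (G.positiveSubsetGraph j).realAdjMatrix_nonneg
    (f := fun t => ∑ v ∈ t.1, r v)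
    (fun t => Finset.sum_pos (fun v _ => hr0 v) (Finset.card_pos.1 (by rw [t.2]; omega)))
    (fun s => by
      rw [positiveSubsetGraph_mulVec_sum hR]
      exact (Finset.sum_le_sum_of_subset_of_nonneg (hsubset s) fun e _ _ => (hr0 _).le).trans
        (hsup s)) hx hxz hle'
  -- A label that does not lift would omit the positive term `r (G.term e)` from the sum,
  -- contradicting harmonicity at `s`.
  have hlift : ∀ s ∈ T, ∀ e, G.init e ∈ s.1 → ∃ ε, (G.positiveSubsetGraph j).init ε = s ∧
      (G.positiveSubsetGraph j).label ε = G.label e := by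
    intro s hs e he
    by_contra hcon
    have h1 := (hT s hs).1
    rw [positiveSubsetGraph_mulVec_sum hR] at h1
    refine absurd (hsup s) (not_le.2 ?_)
    rw [← h1]
    exact Finset.sum_lt_sum_of_subset (hsubset s) (i := e) (by simpa using he)
      (by simp only [Finset.mem_filter]; exact fun h => hcon h.2.2) (hr0 _)
      fun e _ _ => (hr0 _).le
  -- The induction runs over all `s ∈ T`, because reading a letter moves both vertices into another
  -- subset, which closedness keeps in `T`.
  have hacc : ∀ (w : List A), ∀ s ∈ T, ∀ v ∈ s.1, ∀ v' ∈ s.1, G.Accepts v w → G.Accepts v' w := by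
    intro w
    induction w with
    | nil => exact fun _ _ _ _ _ _ _ => trivial
    | cons a w ih =>
      rintro s hs _ hv v' hv' ⟨e, rfl, rfl, hw⟩
      obtain ⟨ε, rfl, hl⟩ := hlift s hs e hv
      obtain ⟨e', rfl, he'⟩ := positiveSubsetGraph_exists_edge hR ε hv'
      refine ⟨e', rfl, he'.trans hl, ih _ ((hT _ hs).2 _
        ((G.positiveSubsetGraph j).realAdjMatrix_pos ε).ne') _
        (positiveSubsetGraph_term_mem hR ε e hv hl.symm) _
        (positiveSubsetGraph_term_mem hR ε e' hv' he') hw⟩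
  obtain ⟨v, hv, v', hv', hne⟩ := Finset.one_lt_card.1
    (show 1 < s₀.1.card by rw [s₀.2]; omega)
  exact hne (hG.eq_of_followerEquiv fun w =>
    ⟨hacc w s₀ hs₀ v hv v' hv', hacc w s₀ hs₀ v' hv' v hv⟩)
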